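/- **Theorem 7.1.** For a positive Borel measure $\sigma$ on $[0,\infty)$ write $f_\sigma(x)=\int_{[0,\infty)}e^{-xt}\,d\sigma(t)$, and let $\mathfrak C_2$ be the set of all functions $f_\sigma$ with $f_\sigma(x)<\infty$ for every $x>0$ and $\|f_\sigma\|_2<\infty$, where $\|\cdot\|_2$ is the norm of $L^2(0,1)$. Let $f_0=f_{\sigma_0}\in\mathfrak C_2$, let $x_0\ge 1$, and let $\delta\in\mathbb R$ satisfy $f_0(x_0)+\delta>0$. Consider the problem $$\min\bigl\{\|f_\sigma-f_0\|_2^2:\ f_\sigma\in\mathfrak C_2,\ f_\sigma(x_0)-f_0(x_0)=\delta\bigr\}.\tag{1}$$ 1. A minimizer $\sigma_*$ of (1) exists and is unique. 2. If $\delta\neq0$, then the (closed) support of $\sigma_*$ either is finite or is a countably infinite set $\{t_n:n\ge1\}$ (with distinct $t_n$) such that $$\sum_{n:\,t_n\ne0}\frac1{t_n}<\infty.\tag{2}$$ 3. Put $C(t)=\int_0^1e^{-xt}\bigl(f_{\sigma_*}(x)-f_0(x)\bigr)dx$. Then $$C(t)\ \ge\ \frac{e^{-x_0t}}{f_0(x_0)+\delta}\int_0^1f_{\sigma_*}(x)\bigl(f_{\sigma_*}(x)-f_0(x)\bigr)dx\qquad\text{for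 all }t\ge0,\tag{3}$$ with equality at every point $t$ of the support of $\sigma_*$. 4. Conversely, let $\sigma_*\ne\sigma_0$ be a positive Borel measure on $[0,\infty)$ with $f_{\sigma_*}\in\mathfrak C_2$, whose support is finite or is a countably infinite set $\{t_n\}$ satisfying (2), and suppose that (3) holds, with equality at every point of the support of $\sigma_*$. Then $\sigma_*$ is a minimizer of (1); in particular, it satisfies the constraint $f_{\sigma_*}(x_0)-f_0(x_0)=\delta$. -/

import Mathlib

open MeasureTheory Set
open scoped NNReal

noncomputable section

namespace CMF

/-- The Laplace transform `f_σ(x) = ∫_{[0,∞)} e^{-xt} dσ(t)` of a positive Borel measure `σ` on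
`[0, ∞)`. It is only used for `x > 0` and for measures for which the integral converges. -/
def laplace (σ : Measure ℝ≥0) (x : ℝ) : ℝ :=
  ∫ t : ℝ≥0, Real.exp (-x * (t : ℝ)) ∂σ

/-- The function `f_σ` belongs to the class `C₂`: it is finite on all of `(0, ∞)`
(so that it is a completely monotone function) and it is in `L²(0,1)`.
The members of the class are, by definition, the functions `f_σ` for such `σ`. -/
structure MemC2 (σ : Measure ℝ≥0) : Prop where
  integrable_exp : ∀ x : ℝ, 0 < x → Integrable (fun t : ℝ≥0 => Real.exp (-x * (t : ℝ))) σ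
  memLp : MemLp (laplace σ) 2 (volume.restrict (Ioo (0 : ℝ) 1))

/-- `‖f_σ - f_{σ₀}‖²` with the norm of `L²(0,1)`. -/
def sqDist (σ σ₀ : Measure ℝ≥0) : ℝ :=
  ∫ x in Ioo (0 : ℝ) 1, (laplace σ x - laplace σ₀ x) ^ 2

/-- `σ` is admissible in the local problem: `f_σ ∈ C₂` and `f_σ(x₀) - f_{σ₀}(x₀) = δ`. -/
def IsAdmissible (σ₀ : Measure ℝ≥0) (x₀ δ : ℝ) (σ : Measure ℝ≥0) : Prop :=
  MemC2 σ ∧ laplace σ x₀ - laplace σ₀ x₀ = δ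

/-- `σ` solves the local problem: it minimizes `‖f_σ - f_{σ₀}‖²` among all admissible measures. -/
def IsMinimizer (σ₀ : Measure ℝ≥0) (x₀ δ : ℝ) (σ : Measure ℝ≥0) : Prop :=
  IsAdmissible σ₀ x₀ δ σ ∧
    ∀ τ : Measure ℝ≥0, IsAdmissible σ₀ x₀ δ τ → sqDist σ σ₀ ≤ sqDist τ σ₀

/-- The Caprini function `C(t) = ∫₀¹ e^{-xt} (f_σ(x) - f_{σ₀}(x)) dx`. -/
def caprini (σ σ₀ : Measure ℝ≥0) (t : ℝ) : ℝ :=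
  ∫ x in Ioo (0 : ℝ) 1, Real.exp (-x * t) * (laplace σ x - laplace σ₀ x)

/-- The right-hand side of the optimality condition,
`e^{-x₀t} / (f_{σ₀}(x₀) + δ) * ∫₀¹ f_σ(x) (f_σ(x) - f_{σ₀}(x)) dx`. -/
def capriniBound (σ σ₀ : Measure ℝ≥0) (x₀ δ t : ℝ) : ℝ :=
  Real.exp (-x₀ * t) / (laplace σ₀ x₀ + δ) *
    ∫ x in Ioo (0 : ℝ) 1, laplace σ x * (laplace σ x - laplace σ₀ x)

/-- The optimality condition: the inequality for all `t ≥ 0`, with equality on the support. -/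
def OptimalityCondition (σ₀ : Measure ℝ≥0) (x₀ δ : ℝ) (σ : Measure ℝ≥0) : Prop :=
  (∀ t : ℝ≥0, capriniBound σ σ₀ x₀ δ t ≤ caprini σ σ₀ t) ∧
    ∀ t ∈ σ.support, caprini σ σ₀ t = capriniBound σ σ₀ x₀ δ t

/-- The (topological) support of `σ` is finite, or it is a countably infinite set
`{t_n}` with `∑ 1 / t_n < ∞`. A possible point `t_n = 0` does not count in the sum
(here `1 / 0 = 0`). -/
def HasSparseSupport (σ : Measure ℝ≥0) : Prop :=
  σ.support.Finite ∨
    ∃ t : ℕ → ℝ≥0, Function.Injective t ∧ range t = σ.support ∧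
      Summable fun n => 1 / (t n : ℝ)

end CMF

end

/-! The constraint and the class are convex, so the problem is the projection of `f_{σ₀}` onto a
convex subset of `L²(0,1)`. A minimizer exists once that subset is closed
(`isClosed_admissibleSet`). The `L²` norm bounds `∫ (1+t)⁻¹ dσ`, and after `s = 1/(1+t)` the
measures live on a compact interval, where `e^{-xt}` becomes a continuous kernel vanishing at `s =
0`. Mass escaping to `t = ∞` is thus invisible at every `x > 0`. Uniqueness follows from the
variational inequality, because the transform on `(0,1)` determines the measure
(`MemC2.eq_of_laplace_ae_eq`).

The variational inequality is linear in the competitor, so it can be tested on point masses; this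
gives the pointwise optimality condition. Conversely, by Fubini, integrating that condition against
a competitor gives back the inequality (`integral_capriniGap`).

For sparsity, the difference of the two sides extends to an entire function bounded on the right
half-plane. It is not identically zero: otherwise `f_σ dx` and `f_{σ₀} dx` would differ by a point
mass at `x₀ ≥ 1`, outside `(0,1)`, which forces `σ = σ₀`. The support consists of zeros of this
function, and the Blaschke condition makes `∑ 1/t` converge. -/

namespace CMF
-- Linearity of the transform and Fubini
section Basic

theorem laplace_nonneg (σ : Measure ℝ≥0) (x : ℝ) : 0 ≤ laplace σ x :=
  integral_nonneg fun _ => (Real.exp_pos _).le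

/-- Integrability of `e^{-t}`, which is bounded below on bounded sets, makes `σ` locally finite;
Fubini needs this. -/
theorem MemC2.sigmaFinite {σ : Measure ℝ≥0} (hσ : MemC2 σ) : SigmaFinite σ := by
  have h := hσ.integrable_exp 1 one_pos
  have : IsLocallyFiniteMeasure σ := by
    refine ⟨fun t => ⟨Iio (t + 1), Iio_mem_nhds (by simp), ?_⟩⟩
    refine lt_of_le_of_lt (measure_mono ?_)
      (h.measure_ge_lt_top (ε := Real.exp (-1 * ((t + 1 : ℝ≥0) : ℝ))) (Real.exp_pos _))
    intro s hs
    have : (s : ℝ) ≤ ((t + 1 : ℝ≥0) : ℝ) := by exact_mod_cast (mem_Iio.1 hs).le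
    simp only [mem_ofPred_eq]
    exact Real.exp_le_exp.2 (by linarith)
  infer_instance

theorem laplace_combo {σ τ : Measure ℝ≥0} {x : ℝ} (a b : ℝ≥0)
    (hσ : Integrable (fun t : ℝ≥0 => Real.exp (-x * (t : ℝ))) σ)
    (hτ : Integrable (fun t : ℝ≥0 => Real.exp (-x * (t : ℝ))) τ) :
    laplace (a • σ + b • τ) x = a * laplace σ x + b * laplace τ x := by
  unfold laplace
  rw [integral_add_measure (hσ.smul_measure_nnreal) (hτ.smul_measure_nnreal)]
  simp [integral_smul_nnreal_measure, NNReal.smul_def]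

theorem MemC2.combo {σ τ : Measure ℝ≥0} (hσ : MemC2 σ) (hτ : MemC2 τ) (a b : ℝ≥0) :
    MemC2 (a • σ + b • τ) := by
  refine ⟨fun x hx => ((hσ.integrable_exp x hx).smul_measure_nnreal).add_measure
    ((hτ.integrable_exp x hx).smul_measure_nnreal), ?_⟩
  refine ((hσ.memLp.const_mul (a : ℝ)).add (hτ.memLp.const_mul (b : ℝ))).ae_eq ?_
  filter_upwards [ae_restrict_mem measurableSet_Ioo] with x hx
  simp [laplace_combo a b (hσ.integrable_exp x hx.1) (hτ.integrable_exp x hx.1)]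

theorem laplace_smul_dirac (a t : ℝ≥0) (x : ℝ) :
    laplace (a • Measure.dirac t) x = a * Real.exp (-x * t) := by
  simp [laplace, integral_smul_nnreal_measure, NNReal.smul_def]

theorem memC2_smul_dirac (a t : ℝ≥0) : MemC2 (a • Measure.dirac t) := by
  refine ⟨fun x _ => (integrable_dirac (by simp)).smul_measure_nnreal, ?_⟩
  have : laplace (a • Measure.dirac t) = fun x => a * Real.exp (-x * t) :=
    funext fun x => laplace_smul_dirac a t x
  rw [this]
  refine MemLp.of_bound (Continuous.aestronglyMeasurable (by fun_prop)) a ?_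
  filter_upwards [ae_restrict_mem measurableSet_Ioo] with x hx
  rw [Real.norm_of_nonneg (by positivity)]
  exact mul_le_of_le_one_right a.2 (Real.exp_le_one_iff.2 (by
    have := mul_nonneg hx.1.le t.2
    change -x * (t : ℝ) ≤ 0
    have : 0 ≤ x * (t : ℝ) := this
    linarith))

theorem MemC2.memLp_sub {σ τ : Measure ℝ≥0} (hσ : MemC2 σ) (hτ : MemC2 τ) :
    MemLp (fun x => laplace σ x - laplace τ x) 2 (volume.restrict (Ioo (0 : ℝ) 1)) :=
  hσ.memLp.sub hτ.memLp

/-- Integrating the absolute value in `t` first leaves `f_τ |h|`, a product of two `L²` functions.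
-/
theorem integrable_exp_mul_prod {τ : Measure ℝ≥0} (hτ : MemC2 τ) {h : ℝ → ℝ}
    (hh : MemLp h 2 (volume.restrict (Ioo (0 : ℝ) 1))) :
    Integrable (fun p : ℝ × ℝ≥0 => Real.exp (-p.1 * p.2) * h p.1)
      ((volume.restrict (Ioo (0 : ℝ) 1)).prod τ) := by
  have := hτ.sigmaFinite
  have hm : AEStronglyMeasurable (fun p : ℝ × ℝ≥0 => Real.exp (-p.1 * p.2) * h p.1)
      ((volume.restrict (Ioo (0 : ℝ) 1)).prod τ) :=
    (Continuous.aestronglyMeasurable (by fun_prop)).mul hh.aestronglyMeasurable.comp_fst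
  rw [integrable_prod_iff hm]
  constructor
  · filter_upwards [ae_restrict_mem measurableSet_Ioo] with x hx
    exact (hτ.integrable_exp x hx.1).mul_const _
  · have : (fun x => ∫ t : ℝ≥0, ‖Real.exp (-x * t) * h x‖ ∂τ) = fun x => laplace τ x * ‖h x‖ := by
      funext x
      simp only [norm_mul, Real.norm_eq_abs, Real.abs_exp]
      rw [integral_mul_const]
      rfl
    rw [this]
    exact hτ.memLp.integrable_mul hh.norm

theorem integrable_integral_exp_mul {τ : Measure ℝ≥0} (hτ : MemC2 τ) {h : ℝ → ℝ}
    (hh : MemLp h 2 (volume.restrict (Ioo (0 : ℝ) 1))) :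
    Integrable (fun t : ℝ≥0 => ∫ x in Ioo (0 : ℝ) 1, Real.exp (-x * t) * h x) τ := by
  have := hτ.sigmaFinite
  exact (integrable_exp_mul_prod hτ hh).integral_prod_right

theorem integral_integral_exp_mul {τ : Measure ℝ≥0} (hτ : MemC2 τ) {h : ℝ → ℝ}
    (hh : MemLp h 2 (volume.restrict (Ioo (0 : ℝ) 1))) :
    ∫ t : ℝ≥0, (∫ x in Ioo (0 : ℝ) 1, Real.exp (-x * t) * h x) ∂τ =
      ∫ x in Ioo (0 : ℝ) 1, laplace τ x * h x := by
  have := hτ.sigmaFinite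
  rw [← integral_integral_swap (integrable_exp_mul_prod hτ hh)]
  refine integral_congr_ae (.of_forall fun x => ?_)
  simp only
  rw [integral_mul_const]
  rfl

end Basic

/-! ### Injectivity of the Laplace transform -/

section Uniqueness

/-- The finite measure `e^{-t/2} dσ(t)`. -/
noncomputable def tilt (σ : Measure ℝ≥0) : Measure ℝ≥0 :=
  σ.withDensity fun t => ENNReal.ofReal (Real.exp (-(1 / 2) * (t : ℝ)))

theorem tilt_injective : Function.Injective tilt := by
  intro σ τ h
  have key : ∀ ρ : Measure ℝ≥0, (tilt ρ).withDensity
      (fun t => ENNReal.ofReal (Real.exp (1 / 2 * (t : ℝ)))) = ρ := by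
    intro ρ
    rw [tilt, ← withDensity_mul _ (by fun_prop) (by fun_prop)]
    convert withDensity_one using 2
    funext t
    simp only [Pi.mul_apply, Pi.one_apply]
    rw [← ENNReal.ofReal_mul (Real.exp_pos _).le, ← Real.exp_add]
    simp
  rw [← key σ, ← key τ, h]

theorem MemC2.isFiniteMeasure_tilt {σ : Measure ℝ≥0} (hσ : MemC2 σ) :
    IsFiniteMeasure (tilt σ) :=
  isFiniteMeasure_withDensity_ofReal (hσ.integrable_exp (1 / 2) (by norm_num)).2

theorem integrable_tilt {σ : Measure ℝ≥0} (hσ : MemC2 σ) {s : ℝ} (hs : s < 1 / 2) :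
    Integrable (fun t : ℝ≥0 => Real.exp (s * (t : ℝ))) (tilt σ) := by
  rw [tilt, integrable_withDensity_iff (by fun_prop) (by simp)]
  convert hσ.integrable_exp (1 / 2 - s) (by linarith) using 2 with t
  rw [ENNReal.toReal_ofReal (Real.exp_pos _).le, ← Real.exp_add]
  ring_nf

/-- The tilt moves `x = 1/2`, interior to `(0,1)`, to the origin. The half-plane of analyticity then
contains the imaginary axis, where characteristic functions live. -/
theorem mgf_tilt {σ : Measure ℝ≥0} (s : ℝ) :
    ProbabilityTheory.mgf (fun t : ℝ≥0 => (t : ℝ)) (tilt σ) s = laplace σ (1 / 2 - s) := by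
  rw [ProbabilityTheory.mgf, tilt, integral_withDensity_eq_integral_toReal_smul
    (by fun_prop) (by simp)]
  refine integral_congr_ae (.of_forall fun t => ?_)
  simp only [smul_eq_mul]
  rw [ENNReal.toReal_ofReal (Real.exp_pos _).le, ← Real.exp_add]
  ring_nf

theorem Iio_subset_integrableExpSet_tilt {σ : Measure ℝ≥0} (hσ : MemC2 σ) :
    Iio (1 / 2) ⊆ interior
      (ProbabilityTheory.integrableExpSet (fun t : ℝ≥0 => (t : ℝ)) (tilt σ)) :=
  interior_maximal (fun _ hs => integrable_tilt hσ hs) isOpen_Iio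

open ProbabilityTheory Filter in
/-- The Laplace transform on `(0, 1)` determines the measure. -/
theorem MemC2.eq_of_laplace_ae_eq {σ τ : Measure ℝ≥0} (hσ : MemC2 σ) (hτ : MemC2 τ)
    (h : laplace σ =ᵐ[volume.restrict (Ioo (0 : ℝ) 1)] laplace τ) : σ = τ := by
  have := hσ.isFiniteMeasure_tilt
  have := hτ.isFiniteMeasure_tilt
  refine tilt_injective ?_
  set X : ℝ≥0 → ℝ := fun t => (t : ℝ)
  have hX : Measurable X := by fun_prop
  have hU : ∀ ρ, MemC2 ρ → AnalyticOnNhd ℂ (complexMGF X (tilt ρ)) {z : ℂ | z.re < 1 / 2} :=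
    fun ρ hρ => analyticOnNhd_complexMGF.mono fun z hz => Iio_subset_integrableExpSet_tilt hρ hz
  -- Almost everywhere equality holds on a dense set, so the points of agreement accumulate at `x =
  -- 1/2`, that is, at `z = 0`.
  have hfr : ∃ᶠ z in nhdsWithin (0 : ℂ) {0}ᶜ, complexMGF X (tilt σ) z = complexMGF X (tilt τ) z := by
    have hae : ∀ᵐ x : ℝ, x ∈ Ioo (0 : ℝ) 1 → laplace σ x = laplace τ x :=
      (ae_restrict_iff' measurableSet_Ioo).1 h
    have hd : Dense ({x : ℝ | x ∈ Ioo (0 : ℝ) 1 → laplace σ x = laplace τ x} \ {1 / 2}) :=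
      (Measure.dense_of_ae hae).sdiff_singleton _
    have h1 := mem_closure_iff_frequently.1 (hd (1 / 2))
    have h2 : ∃ᶠ x : ℝ in nhds (1 / 2), x ≠ 1 / 2 ∧ laplace σ x = laplace τ x := by
      refine (h1.and_eventually (Ioo_mem_nhds (a := (0 : ℝ)) (b := 1) (by norm_num)
        (by norm_num))).mono fun x hx => ⟨hx.1.2, hx.1.1 hx.2⟩
    have h3 : ∃ᶠ x : ℝ in nhdsWithin (1 / 2) {1 / 2}ᶜ, laplace σ x = laplace τ x :=
      frequently_nhdsWithin_iff.2 (h2.mono fun x hx => ⟨hx.2, hx.1⟩)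
    refine Tendsto.frequently_map (l₁ := nhdsWithin (1 / 2 : ℝ) {1 / 2}ᶜ)
      (fun x : ℝ => ((1 / 2 - x : ℝ) : ℂ)) ?_ ?_ h3
    · refine tendsto_nhdsWithin_iff.2 ⟨?_, ?_⟩
      · exact (Continuous.tendsto' (by fun_prop) _ _ (by simp)).mono_left nhdsWithin_le_nhds
      · filter_upwards [self_mem_nhdsWithin] with x hx h0
        have : (1 / 2 - x : ℝ) = 0 := Complex.ofReal_injective (by simpa using h0)
        exact hx (by simp only [mem_singleton_iff]; linarith)
    · intro x hx
      rw [complexMGF_ofReal, complexMGF_ofReal, mgf_tilt, mgf_tilt]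
      simpa using hx
  have heq := (hU σ hσ).eqOn_of_preconnected_of_frequently_eq (hU τ hτ)
    ((convex_halfSpace_re_lt _).isPreconnected) (by simp) hfr
  have hmap : (tilt σ).map X = (tilt τ).map X := by
    refine Measure.ext_of_charFun (funext fun s => ?_)
    rw [← complexMGF_mul_I hX.aemeasurable, ← complexMGF_mul_I hX.aemeasurable]
    exact heq (by simp)
  have hemb : MeasurableEmbedding X := MeasurableEmbedding.subtype_coe measurableSet_Ici
  rw [← hemb.comap_map (tilt σ), hmap, hemb.comap_map]

end Uniqueness

/-! ### Compactness after the change of variable `s = 1/(1+t)` -/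

section Selection
open Filter Topology

/-- For `0 < x < 1/(1+t)` one has `xt ≤ 1`, so the integrand is at least `e⁻¹` on an interval of
length `1/(1+t)`. -/
theorem one_div_one_add_le (t : ℝ≥0) :
    ENNReal.ofReal (1 + (t : ℝ))⁻¹ ≤
      ENNReal.ofReal (Real.exp 1) *
        ∫⁻ x in Ioo (0 : ℝ) 1, ENNReal.ofReal (Real.exp (-x * (t : ℝ))) := by
  have ht : 0 ≤ (t : ℝ) := t.2
  set b : ℝ := (1 + (t : ℝ))⁻¹ with hb
  have hb0 : 0 < b := by positivity
  have hb1 : b ≤ 1 := inv_le_one_of_one_le₀ (by linarith)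
  have h1 : ENNReal.ofReal (Real.exp (-1)) * ENNReal.ofReal b ≤
      ∫⁻ x in Ioo (0 : ℝ) 1, ENNReal.ofReal (Real.exp (-x * (t : ℝ))) := by
    calc _ = ∫⁻ _ in Ioo (0 : ℝ) b, ENNReal.ofReal (Real.exp (-1)) := by simp
      _ ≤ ∫⁻ x in Ioo (0 : ℝ) b, ENNReal.ofReal (Real.exp (-x * (t : ℝ))) := by
        refine setLIntegral_mono (by fun_prop) fun x hx => ?_
        refine ENNReal.ofReal_le_ofReal (Real.exp_le_exp.2 ?_)
        have : b * (1 + (t : ℝ)) = 1 := inv_mul_cancel₀ (by positivity)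
        have := mul_le_mul_of_nonneg_right hx.2.le ht
        nlinarith
      _ ≤ _ := lintegral_mono_set (Ioo_subset_Ioo_right hb1)
  calc ENNReal.ofReal b
      = ENNReal.ofReal (Real.exp 1) * (ENNReal.ofReal (Real.exp (-1)) * ENNReal.ofReal b) := by
        rw [← mul_assoc, ← ENNReal.ofReal_mul (Real.exp_pos _).le, ← Real.exp_add]; simp
    _ ≤ _ := by gcongr

/-- The `L²(0,1)` norm of `f_σ` controls `∫ (1 + t)⁻¹ dσ(t)`. -/
theorem MemC2.lintegral_one_div_one_add_le {σ : Measure ℝ≥0} (hσ : MemC2 σ) :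
    ∫⁻ t : ℝ≥0, ENNReal.ofReal (1 + (t : ℝ))⁻¹ ∂σ ≤
      ENNReal.ofReal (Real.exp 1) *
        eLpNorm (laplace σ) 2 (volume.restrict (Ioo (0 : ℝ) 1)) := by
  have := hσ.sigmaFinite
  calc _ ≤ ∫⁻ t : ℝ≥0, ENNReal.ofReal (Real.exp 1) *
        (∫⁻ x in Ioo (0 : ℝ) 1, ENNReal.ofReal (Real.exp (-x * (t : ℝ)))) ∂σ :=
        lintegral_mono one_div_one_add_le
    _ = ENNReal.ofReal (Real.exp 1) * ∫⁻ x in Ioo (0 : ℝ) 1,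
        ∫⁻ t : ℝ≥0, ENNReal.ofReal (Real.exp (-x * (t : ℝ))) ∂σ := by
        rw [lintegral_const_mul' _ _ (by simp), lintegral_lintegral_swap]
        exact Measurable.aemeasurable (by unfold Function.uncurry; fun_prop)
    _ = ENNReal.ofReal (Real.exp 1) *
        eLpNorm (laplace σ) 1 (volume.restrict (Ioo (0 : ℝ) 1)) := by
        rw [eLpNorm_one_eq_lintegral_enorm]
        congr 1
        refine lintegral_congr_ae ?_
        filter_upwards [ae_restrict_mem measurableSet_Ioo] with x hx
        rw [Real.enorm_of_nonneg (laplace_nonneg _ _), laplace,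
          ofReal_integral_eq_lintegral_ofReal (hσ.integrable_exp x hx.1)
            (.of_forall fun _ => (Real.exp_pos _).le)]
    _ ≤ ENNReal.ofReal (Real.exp 1) *
        eLpNorm (laplace σ) 2 (volume.restrict (Ioo (0 : ℝ) 1)) := by
        gcongr
        refine (eLpNorm_le_eLpNorm_mul_rpow_measure_univ (p := 1) (q := 2) (by norm_num)
          hσ.memLp.aestronglyMeasurable).trans_eq ?_
        simp

/-- The homeomorphism `t ↦ 1 / (1 + t)` of `[0, ∞)` onto `(0, 1]`, with values in `[0, 1]`. -/
noncomputable def toUnit (t : ℝ≥0) : unitInterval :=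
  ⟨(1 + (t : ℝ))⁻¹, by have := t.2; positivity,
    inv_le_one_of_one_le₀ (le_add_of_nonneg_right t.2)⟩

/-- The inverse of `toUnit`. -/
noncomputable def ofUnit (s : unitInterval) : ℝ≥0 := Real.toNNReal ((s : ℝ)⁻¹ - 1)

theorem measurable_toUnit : Measurable toUnit :=
  Measurable.subtype_mk (by fun_prop)

theorem measurable_ofUnit : Measurable ofUnit := by
  unfold ofUnit; fun_prop

/-- The kernel `e^{-xt}` relative to the weight `1 / (1 + t)`, in the variable `s = 1 / (1 + t)`. -/
noncomputable def unitKernel (x : ℝ) (s : unitInterval) : ℝ := (s : ℝ)⁻¹ * Real.exp (-x * ((s : ℝ)⁻¹ - 1))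

theorem unitKernel_nonneg (x : ℝ) (s : unitInterval) : 0 ≤ unitKernel x s :=
  mul_nonneg (inv_nonneg.2 s.2.1) (Real.exp_pos _).le

/-- With `y = 1/s`, the quadratic term of `e^{xy}` beats the factor `y` and leaves a factor `s`.
This gives continuity at `s = 0`, where `0⁻¹ = 0` makes the kernel vanish. -/
theorem unitKernel_le {x : ℝ} (hx : 0 < x) (s : unitInterval) :
    unitKernel x s ≤ 2 * Real.exp x / x ^ 2 * s := by
  rcases s.2.1.eq_or_lt with hs | hs
  · simp [unitKernel, ← hs]
  set y : ℝ := (s : ℝ)⁻¹ with hy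
  have hy0 : 0 < y := inv_pos.2 hs
  have hsy : (s : ℝ) = y⁻¹ := by simp [hy]
  have h1 : (x * y) ^ 2 / 2 ≤ Real.exp (x * y) := by
    simpa using Real.pow_div_factorial_le_exp (x * y) (by positivity) 2
  have h2 : unitKernel x s = y * (Real.exp x / Real.exp (x * y)) := by
    rw [unitKernel, ← Real.exp_sub, ← hy]; ring_nf
  rw [h2, hsy]
  calc y * (Real.exp x / Real.exp (x * y)) ≤ y * (Real.exp x / ((x * y) ^ 2 / 2)) := by gcongr
    _ = _ := by field_simp

theorem continuous_unitKernel {x : ℝ} (hx : 0 < x) : Continuous (unitKernel x) := by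
  rw [continuous_iff_continuousAt]
  intro s
  by_cases hs : (s : ℝ) = 0
  · have h0 : unitKernel x s = 0 := by simp [unitKernel, hs]
    rw [ContinuousAt, h0]
    refine squeeze_zero (unitKernel_nonneg x) (unitKernel_le hx) ?_
    exact Continuous.tendsto' (by fun_prop) _ _ (by simp [hs])
  · have : ContinuousAt (fun u : unitInterval => (u : ℝ)⁻¹) s :=
      (continuous_subtype_val.continuousAt).inv₀ hs
    unfold unitKernel
    fun_prop

theorem unitKernel_toUnit (x : ℝ) (t : ℝ≥0) :
    (1 + (t : ℝ))⁻¹ * unitKernel x (toUnit t) = Real.exp (-x * t) := by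
  have : 0 < 1 + (t : ℝ) := by have := t.2; positivity
  simp only [unitKernel, toUnit, inv_inv, add_sub_cancel_left]
  rw [← mul_assoc, inv_mul_cancel₀ this.ne', one_mul]

theorem inv_mul_exp_ofUnit (x : ℝ) (s : unitInterval) :
    (s : ℝ)⁻¹ * Real.exp (-x * (ofUnit s : ℝ)) = unitKernel x s := by
  rcases s.2.1.eq_or_lt with hs | hs
  · simp [unitKernel, ← hs]
  · rw [unitKernel, ofUnit, Real.coe_toNNReal _ (sub_nonneg.2 ((one_le_inv₀ hs).2 s.2.2))]

/-- The image of the measure `(1 + t)⁻¹ dσ(t)` under `t ↦ 1 / (1 + t)`. -/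
noncomputable def unitMeasure (σ : Measure ℝ≥0) : Measure unitInterval :=
  (σ.withDensity fun t => ENNReal.ofReal (1 + (t : ℝ))⁻¹).map toUnit

theorem unitMeasure_univ (σ : Measure ℝ≥0) :
    unitMeasure σ univ = ∫⁻ t : ℝ≥0, ENNReal.ofReal (1 + (t : ℝ))⁻¹ ∂σ := by
  rw [unitMeasure, Measure.map_apply measurable_toUnit .univ]
  simp

theorem integral_unitKernel_unitMeasure (σ : Measure ℝ≥0) {x : ℝ} (hx : 0 < x) :
    ∫ s, unitKernel x s ∂(unitMeasure σ) = laplace σ x := by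
  rw [unitMeasure, integral_map measurable_toUnit.aemeasurable
    (continuous_unitKernel hx).aestronglyMeasurable,
    integral_withDensity_eq_integral_toReal_smul (by fun_prop) (by simp)]
  refine integral_congr_ae (.of_forall fun t => ?_)
  have : 0 ≤ (1 + (t : ℝ))⁻¹ := by have := t.2; positivity
  simp only [smul_eq_mul]
  rw [ENNReal.toReal_ofReal this, unitKernel_toUnit]

/-- The inverse construction to `unitMeasure`; a possible atom at `0` is discarded. -/
noncomputable def ofUnitMeasure (ν : Measure unitInterval) : Measure ℝ≥0 :=
  (ν.withDensity fun s => ENNReal.ofReal (s : ℝ)⁻¹).map ofUnit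

theorem integrable_exp_ofUnitMeasure (ν : Measure unitInterval) [IsFiniteMeasure ν] {x : ℝ}
    (hx : 0 < x) : Integrable (fun t : ℝ≥0 => Real.exp (-x * (t : ℝ))) (ofUnitMeasure ν) := by
  rw [ofUnitMeasure, integrable_map_measure (by fun_prop) measurable_ofUnit.aemeasurable,
    integrable_withDensity_iff (by fun_prop) (by simp)]
  refine ((continuous_unitKernel hx).integrable_of_hasCompactSupport (μ := ν)
    (HasCompactSupport.of_compactSpace _)).congr (.of_forall fun s => ?_)
  simp only [Function.comp]
  rw [ENNReal.toReal_ofReal (inv_nonneg.2 s.2.1), mul_comm, inv_mul_exp_ofUnit]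

theorem laplace_ofUnitMeasure (ν : Measure unitInterval) (x : ℝ) :
    laplace (ofUnitMeasure ν) x = ∫ s, unitKernel x s ∂ν := by
  rw [laplace, ofUnitMeasure, integral_map measurable_ofUnit.aemeasurable
    (Continuous.aestronglyMeasurable (by fun_prop)),
    integral_withDensity_eq_integral_toReal_smul (by fun_prop) (by simp)]
  refine integral_congr_ae (.of_forall fun s => ?_)
  simp only [smul_eq_mul]
  rw [ENNReal.toReal_ofReal (inv_nonneg.2 s.2.1), inv_mul_exp_ofUnit]

/-- A selection theorem for Laplace transforms. -/
theorem exists_tendsto_laplace (σ : ℕ → Measure ℝ≥0) (M : ℝ≥0)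
    (hM : ∀ n, ∫⁻ t : ℝ≥0, ENNReal.ofReal (1 + (t : ℝ))⁻¹ ∂(σ n) ≤ M) :
    ∃ τ : Measure ℝ≥0,
      (∀ x : ℝ, 0 < x → Integrable (fun t : ℝ≥0 => Real.exp (-x * (t : ℝ))) τ) ∧
      ∃ F : Filter ℕ, F.NeBot ∧ F ≤ atTop ∧
        ∀ x : ℝ, 0 < x → Tendsto (fun n => laplace (σ n) x) F (𝓝 (laplace τ x)) := by
  have hle : ∀ n, unitMeasure (σ n) univ ≤ M := fun n => (unitMeasure_univ _).trans_le (hM n)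
  let m : ℕ → FiniteMeasure unitInterval := fun n =>
    ⟨unitMeasure (σ n), ⟨(hle n).trans_lt ENNReal.coe_lt_top⟩⟩
  have hm : ∀ n, m n ∈ {μ : FiniteMeasure unitInterval | μ.mass ≤ M} := by
    intro n
    change (m n).mass ≤ M
    rw [← ENNReal.coe_le_coe, FiniteMeasure.ennreal_mass]
    exact hle n
  -- Finite measures of bounded mass on a compact space form a compact set; a limit along an
  -- ultrafilter is enough, no subsequence is needed.
  obtain ⟨ν, -, hν⟩ := (isCompact_setOfPred_finiteMeasure_le_of_compactSpace
    unitInterval M).ultrafilter_le_nhds' ((hyperfilter ℕ).map m)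
    (Filter.mem_map.2 (Filter.univ_mem' hm))
  have hν : Tendsto m (hyperfilter ℕ) (𝓝 ν) := hν
  refine ⟨ofUnitMeasure ν, fun x hx => integrable_exp_ofUnitMeasure _ hx, hyperfilter ℕ,
    inferInstance, Nat.hyperfilter_le_atTop, fun x hx => ?_⟩
  have := FiniteMeasure.tendsto_iff_forall_integral_tendsto.1 hν
    (BoundedContinuousFunction.mkOfCompact ⟨unitKernel x, continuous_unitKernel hx⟩)
  rw [laplace_ofUnitMeasure]
  refine this.congr fun n => ?_
  exact integral_unitKernel_unitMeasure (σ n) hx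

end Selection

/-! ### Projection onto the admissible set in `L²(0,1)` -/

section Minimizers
open Filter Topology

/-- The functions `f_σ` of the admissible measures `σ`, as elements of `L²(0,1)`. -/
def admissibleSet (x₀ c : ℝ) : Set (Lp ℝ 2 (volume.restrict (Ioo (0 : ℝ) 1))) :=
  {F | ∃ σ : Measure ℝ≥0, ∃ h : MemC2 σ, laplace σ x₀ = c ∧ h.memLp.toLp (laplace σ) = F}

theorem convex_admissibleSet {x₀ : ℝ} (hx₀ : 0 < x₀) (c : ℝ) : Convex ℝ (admissibleSet x₀ c) := by
  rintro _ ⟨σ, hσ, hσc, rfl⟩ _ ⟨τ, hτ, hτc, rfl⟩ a b ha hb hab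
  lift a to ℝ≥0 using ha
  lift b to ℝ≥0 using hb
  refine ⟨a • σ + b • τ, hσ.combo hτ _ _, ?_, ?_⟩
  · rw [laplace_combo _ _ (hσ.integrable_exp _ hx₀) (hτ.integrable_exp _ hx₀), hσc, hτc]
    rw [← add_mul, hab, one_mul]
  · rw [← MemLp.toLp_const_smul, ← MemLp.toLp_const_smul, ← MemLp.toLp_add]
    refine MemLp.toLp_congr _ _ ?_
    filter_upwards [ae_restrict_mem measurableSet_Ioo] with x hx
    rw [laplace_combo _ _ (hσ.integrable_exp x hx.1) (hτ.integrable_exp x hx.1)]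
    rfl

theorem isClosed_admissibleSet {x₀ : ℝ} (hx₀ : 0 < x₀) (c : ℝ) :
    IsClosed (admissibleSet x₀ c) := by
  refine IsSeqClosed.isClosed fun F G hF hFG => ?_
  choose σ hσ hσc hσF using hF
  obtain ⟨R, hR⟩ := hFG.norm.bddAbove_range
  have hM : ∀ n, ∫⁻ t : ℝ≥0, ENNReal.ofReal (1 + (t : ℝ))⁻¹ ∂(σ n) ≤
      ((Real.toNNReal (Real.exp 1) * Real.toNNReal R : ℝ≥0) : ENNReal) := by
    intro n
    refine (hσ n).lintegral_one_div_one_add_le.trans ?_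
    rw [ENNReal.coe_mul]
    refine mul_le_mul' le_rfl ?_
    have h1 : ‖F n‖ ≤ R := hR (mem_range_self n)
    rw [← hσF n, Lp.norm_toLp] at h1
    exact (ENNReal.le_ofReal_iff_toReal_le (hσ n).memLp.eLpNorm_ne_top
      (ENNReal.toReal_nonneg.trans h1)).2 h1
  obtain ⟨φ, hφ, hae⟩ := (tendstoInMeasure_of_tendsto_Lp hFG).exists_seq_tendsto_ae
  obtain ⟨τ, hτ, 𝓕, hne, hle, hlim⟩ := exists_tendsto_laplace (fun n => σ (φ n)) _
    (fun n => hM (φ n))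
  -- The almost everywhere limit of the subsequence and the pointwise limit along the finer filter
  -- `𝓕` must coincide.
  have hGτ : G =ᵐ[volume.restrict (Ioo (0 : ℝ) 1)] laplace τ := by
    have hall : ∀ᵐ x ∂(volume.restrict (Ioo (0 : ℝ) 1)), ∀ n, F n x = laplace (σ n) x := by
      refine ae_all_iff.2 fun n => ?_
      rw [← hσF n]
      exact (hσ n).memLp.coeFn_toLp
    filter_upwards [hae, hall, ae_restrict_mem measurableSet_Ioo] with x h1 h2 hx
    refine tendsto_nhds_unique (h1.mono_left hle) ?_
    simpa only [h2] using hlim x hx.1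
  have hτ2 : MemC2 τ := ⟨hτ, (Lp.memLp G).ae_eq hGτ⟩
  refine ⟨τ, hτ2, ?_, ?_⟩
  -- The constraint survives because the selection theorem gives convergence at every `x > 0`,
  -- including outside `(0,1)`.
  · refine tendsto_nhds_unique (hlim x₀ hx₀) ?_
    simp only [hσc]
    exact tendsto_const_nhds
  · refine Lp.ext ?_
    exact hτ2.memLp.coeFn_toLp.trans hGτ.symm

theorem nonempty_admissibleSet (x₀ : ℝ) {c : ℝ} (hc : 0 ≤ c) : (admissibleSet x₀ c).Nonempty :=
  ⟨_, c.toNNReal • Measure.dirac 0, memC2_smul_dirac _ _, by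
    rw [laplace_smul_dirac]; simp [hc], rfl⟩

theorem integral_mul_eq_inner {f g : ℝ → ℝ} {μ : Measure ℝ} (hf : MemLp f 2 μ)
    (hg : MemLp g 2 μ) : ∫ x, f x * g x ∂μ = inner ℝ (hf.toLp f) (hg.toLp g) := by
  rw [L2.inner_def]
  refine integral_congr_ae ?_
  filter_upwards [hf.coeFn_toLp, hg.coeFn_toLp] with x h1 h2
  simp [h1, h2, mul_comm]

theorem sqDist_eq_norm_sq {σ τ : Measure ℝ≥0} (hσ : MemC2 σ) (hτ : MemC2 τ) :
    sqDist σ τ = ‖hσ.memLp.toLp (laplace σ) - hτ.memLp.toLp (laplace τ)‖ ^ 2 := by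
  rw [← MemLp.toLp_sub, ← real_inner_self_eq_norm_sq]
  simp only [sqDist, pow_two]
  exact integral_mul_eq_inner (hσ.memLp_sub hτ) (hσ.memLp_sub hτ)

theorem isAdmissible_iff {σ₀ σ : Measure ℝ≥0} {x₀ δ : ℝ} :
    IsAdmissible σ₀ x₀ δ σ ↔ MemC2 σ ∧ laplace σ x₀ = laplace σ₀ x₀ + δ := by
  rw [IsAdmissible, sub_eq_iff_eq_add']

theorem isMinimizer_iff_norm {σ₀ σ : Measure ℝ≥0} {x₀ δ : ℝ} (hσ₀ : MemC2 σ₀) (hσ : MemC2 σ)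
    (hc : laplace σ x₀ = laplace σ₀ x₀ + δ) :
    IsMinimizer σ₀ x₀ δ σ ↔
      ‖hσ₀.memLp.toLp (laplace σ₀) - hσ.memLp.toLp (laplace σ)‖ =
        ⨅ w : admissibleSet x₀ (laplace σ₀ x₀ + δ), ‖hσ₀.memLp.toLp (laplace σ₀) - w‖ := by
  have hmem : hσ.memLp.toLp (laplace σ) ∈ admissibleSet x₀ (laplace σ₀ x₀ + δ) :=
    ⟨σ, hσ, hc, rfl⟩
  have : Nonempty (admissibleSet x₀ (laplace σ₀ x₀ + δ)) := ⟨⟨_, hmem⟩⟩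
  have hbdd : BddBelow (range fun w : admissibleSet x₀ (laplace σ₀ x₀ + δ) =>
      ‖hσ₀.memLp.toLp (laplace σ₀) - w‖) := ⟨0, by rintro _ ⟨w, rfl⟩; exact norm_nonneg _⟩
  constructor
  · rintro ⟨-, hmin⟩
    refine le_antisymm (le_ciInf ?_) (ciInf_le hbdd ⟨_, hmem⟩)
    rintro ⟨_, τ, hτ, hτc, rfl⟩
    have := hmin τ (isAdmissible_iff.2 ⟨hτ, hτc⟩)
    rw [sqDist_eq_norm_sq hσ hσ₀, sqDist_eq_norm_sq hτ hσ₀] at this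
    rw [norm_sub_rev, norm_sub_rev (hσ₀.memLp.toLp (laplace σ₀))]
    exact (pow_le_pow_iff_left₀ (norm_nonneg _) (norm_nonneg _) two_ne_zero).1 this
  · intro h
    refine ⟨isAdmissible_iff.2 ⟨hσ, hc⟩, fun τ hτ => ?_⟩
    obtain ⟨hτ, hτc⟩ := isAdmissible_iff.1 hτ
    rw [sqDist_eq_norm_sq hσ hσ₀, sqDist_eq_norm_sq hτ hσ₀, norm_sub_rev,
      norm_sub_rev (hτ.memLp.toLp (laplace τ)), h]
    gcongr
    · exact le_ciInf fun _ => norm_nonneg _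
    · exact ciInf_le hbdd ⟨_, τ, hτ, hτc, rfl⟩

/-- The variational inequality characterizing minimizers. -/
theorem isMinimizer_iff_integral {σ₀ σ : Measure ℝ≥0} {x₀ δ : ℝ} (hx₀ : 0 < x₀) (hσ₀ : MemC2 σ₀)
    (hσ : MemC2 σ) (hc : laplace σ x₀ = laplace σ₀ x₀ + δ) :
    IsMinimizer σ₀ x₀ δ σ ↔ ∀ τ, MemC2 τ → laplace τ x₀ = laplace σ₀ x₀ + δ →
      ∫ x in Ioo (0 : ℝ) 1, laplace σ x * (laplace σ x - laplace σ₀ x) ≤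
        ∫ x in Ioo (0 : ℝ) 1, laplace τ x * (laplace σ x - laplace σ₀ x) := by
  have hmem : hσ.memLp.toLp (laplace σ) ∈ admissibleSet x₀ (laplace σ₀ x₀ + δ) :=
    ⟨σ, hσ, hc, rfl⟩
  rw [isMinimizer_iff_norm hσ₀ hσ hc,
    norm_eq_iInf_iff_real_inner_le_zero (convex_admissibleSet hx₀ _) hmem]
  have key : ∀ τ (hτ : MemC2 τ), inner ℝ (hσ₀.memLp.toLp (laplace σ₀) - hσ.memLp.toLp (laplace σ))
      (hτ.memLp.toLp (laplace τ) - hσ.memLp.toLp (laplace σ)) =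
      (∫ x in Ioo (0 : ℝ) 1, laplace σ x * (laplace σ x - laplace σ₀ x)) -
        ∫ x in Ioo (0 : ℝ) 1, laplace τ x * (laplace σ x - laplace σ₀ x) := by
    intro τ hτ
    rw [integral_mul_eq_inner hσ.memLp (hσ.memLp_sub hσ₀),
      integral_mul_eq_inner hτ.memLp (hσ.memLp_sub hσ₀), ← inner_sub_left]
    have : (hσ.memLp_sub hσ₀).toLp (fun x => laplace σ x - laplace σ₀ x) =
      hσ.memLp.toLp (laplace σ) - hσ₀.memLp.toLp (laplace σ₀) := rfl
    rw [this, real_inner_comm, ← neg_sub (hτ.memLp.toLp _), ← neg_sub (hσ₀.memLp.toLp _),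
      inner_neg_neg]
  constructor
  · intro h τ hτ hτc
    have := h _ ⟨τ, hτ, hτc, rfl⟩
    rw [key τ hτ] at this
    linarith
  · rintro h _ ⟨τ, hτ, hτc, rfl⟩
    rw [key τ hτ]
    linarith [h τ hτ hτc]

theorem exists_isMinimizer {σ₀ : Measure ℝ≥0} {x₀ δ : ℝ} (hx₀ : 0 < x₀) (hσ₀ : MemC2 σ₀)
    (hc : 0 ≤ laplace σ₀ x₀ + δ) : ∃ σ, IsMinimizer σ₀ x₀ δ σ := by
  obtain ⟨_, ⟨σ, hσ, hσc, rfl⟩, h⟩ := exists_norm_eq_iInf_of_complete_convex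
    (nonempty_admissibleSet x₀ hc) (isClosed_admissibleSet hx₀ _).isComplete
    (convex_admissibleSet hx₀ _) (hσ₀.memLp.toLp (laplace σ₀))
  exact ⟨σ, (isMinimizer_iff_norm hσ₀ hσ hσc).2 h⟩

theorem MemC2.integrable_mul {ρ : Measure ℝ≥0} (hρ : MemC2 ρ) {h : ℝ → ℝ}
    (hh : MemLp h 2 (volume.restrict (Ioo (0 : ℝ) 1))) :
    IntegrableOn (fun x => laplace ρ x * h x) (Ioo 0 1) :=
  hρ.memLp.integrable_mul hh

theorem MemC2.eq_of_integral_sq_sub_nonpos {σ τ : Measure ℝ≥0} (hσ : MemC2 σ) (hτ : MemC2 τ)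
    (h : ∫ x in Ioo (0 : ℝ) 1, (laplace σ x - laplace τ x) ^ 2 ≤ 0) : σ = τ := by
  refine hσ.eq_of_laplace_ae_eq hτ ?_
  have h0 := le_antisymm h (integral_nonneg fun x => sq_nonneg _)
  rw [integral_eq_zero_iff_of_nonneg (fun x => sq_nonneg _) (hσ.memLp_sub hτ).integrable_sq] at h0
  filter_upwards [h0] with x hx
  exact sub_eq_zero.1 (pow_eq_zero_iff two_ne_zero |>.1 hx)

/-- Each minimizer is tested against the other; the two variational inequalities add up to `‖f_σ -
f_τ‖² ≤ 0`. -/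
theorem IsMinimizer.unique {σ₀ σ τ : Measure ℝ≥0} {x₀ δ : ℝ} (hx₀ : 0 < x₀) (hσ₀ : MemC2 σ₀)
    (hσ : IsMinimizer σ₀ x₀ δ σ) (hτ : IsMinimizer σ₀ x₀ δ τ) : σ = τ := by
  obtain ⟨hσ2, hσc⟩ := isAdmissible_iff.1 hσ.1
  obtain ⟨hτ2, hτc⟩ := isAdmissible_iff.1 hτ.1
  have h1 := (isMinimizer_iff_integral hx₀ hσ₀ hσ2 hσc).1 hσ τ hτ2 hτc
  have h2 := (isMinimizer_iff_integral hx₀ hσ₀ hτ2 hτc).1 hτ σ hσ2 hσc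
  refine hσ2.eq_of_integral_sq_sub_nonpos hτ2 ?_
  have hs := hσ2.memLp_sub hσ₀
  have ht := hτ2.memLp_sub hσ₀
  have : ∫ x in Ioo (0 : ℝ) 1, (laplace σ x - laplace τ x) ^ 2 =
      ((∫ x in Ioo (0 : ℝ) 1, laplace σ x * (laplace σ x - laplace σ₀ x)) -
        ∫ x in Ioo (0 : ℝ) 1, laplace τ x * (laplace σ x - laplace σ₀ x)) +
      ((∫ x in Ioo (0 : ℝ) 1, laplace τ x * (laplace τ x - laplace σ₀ x)) -
        ∫ x in Ioo (0 : ℝ) 1, laplace σ x * (laplace τ x - laplace σ₀ x)) := by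
    rw [← integral_sub (hσ2.integrable_mul hs) (hτ2.integrable_mul hs),
      ← integral_sub (hτ2.integrable_mul ht) (hσ2.integrable_mul ht)]
    refine Eq.trans ?_ (integral_add ((hσ2.integrable_mul hs).sub (hτ2.integrable_mul hs))
      ((hτ2.integrable_mul ht).sub (hσ2.integrable_mul ht)))
    congr 1 with x
    ring
  linarith

end Minimizers

/-! ### Equivalence with the pointwise optimality condition -/

section Optimality

/-- The difference of the two sides of the optimality condition. -/
noncomputable def capriniGap (σ σ₀ : Measure ℝ≥0) (x₀ δ t : ℝ) : ℝ :=
  caprini σ σ₀ t - capriniBound σ σ₀ x₀ δ t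

theorem continuous_caprini {σ σ₀ : Measure ℝ≥0} (hσ : MemC2 σ) (hσ₀ : MemC2 σ₀) :
    Continuous fun t : ℝ≥0 => caprini σ σ₀ t := by
  have hh := hσ.memLp_sub hσ₀
  refine continuous_of_dominated (bound := fun x => ‖laplace σ x - laplace σ₀ x‖) (fun t => ?_)
    (fun t => ?_) (hh.integrable one_le_two).norm (.of_forall fun x => by fun_prop)
  · exact (Continuous.aestronglyMeasurable (by fun_prop)).mul hh.aestronglyMeasurable
  · filter_upwards [ae_restrict_mem measurableSet_Ioo] with x hx
    rw [norm_mul, Real.norm_of_nonneg (Real.exp_pos _).le]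
    refine mul_le_of_le_one_left (norm_nonneg _) (Real.exp_le_one_iff.2 ?_)
    rw [neg_mul]
    exact neg_nonpos.2 (mul_nonneg hx.1.le t.2)

theorem continuous_capriniGap {σ σ₀ : Measure ℝ≥0} (hσ : MemC2 σ) (hσ₀ : MemC2 σ₀) (x₀ δ : ℝ) :
    Continuous fun t : ℝ≥0 => capriniGap σ σ₀ x₀ δ t := by
  refine (continuous_caprini hσ hσ₀).sub ?_
  unfold capriniBound
  fun_prop

theorem integrable_capriniBound {σ σ₀ τ : Measure ℝ≥0} {x₀ : ℝ} (hx₀ : 0 < x₀) (δ : ℝ)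
    (hτ : MemC2 τ) : Integrable (fun t : ℝ≥0 => capriniBound σ σ₀ x₀ δ t) τ :=
  ((hτ.integrable_exp x₀ hx₀).div_const _).mul_const _

theorem integrable_capriniGap {σ σ₀ τ : Measure ℝ≥0} {x₀ : ℝ} (hx₀ : 0 < x₀) (δ : ℝ)
    (hσ : MemC2 σ) (hσ₀ : MemC2 σ₀) (hτ : MemC2 τ) :
    Integrable (fun t : ℝ≥0 => capriniGap σ σ₀ x₀ δ t) τ :=
  (integrable_integral_exp_mul hτ (hσ.memLp_sub hσ₀)).sub (integrable_capriniBound hx₀ δ hτ)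

/-- For admissible `τ` the quotient is `1`, and the right side is the difference in
`isMinimizer_iff_integral`; for `τ = σ` it is then zero. -/
theorem integral_capriniGap {σ σ₀ τ : Measure ℝ≥0} {x₀ : ℝ} (hx₀ : 0 < x₀) (δ : ℝ)
    (hσ : MemC2 σ) (hσ₀ : MemC2 σ₀) (hτ : MemC2 τ) :
    ∫ t : ℝ≥0, capriniGap σ σ₀ x₀ δ t ∂τ =
      (∫ x in Ioo (0 : ℝ) 1, laplace τ x * (laplace σ x - laplace σ₀ x)) -
        laplace τ x₀ / (laplace σ₀ x₀ + δ) *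
          ∫ x in Ioo (0 : ℝ) 1, laplace σ x * (laplace σ x - laplace σ₀ x) := by
  have hh := hσ.memLp_sub hσ₀
  have hC : Integrable (fun t : ℝ≥0 => caprini σ σ₀ t) τ := integrable_integral_exp_mul hτ hh
  unfold capriniGap
  rw [integral_sub hC (integrable_capriniBound hx₀ δ hτ)]
  congr 1
  · exact integral_integral_exp_mul hτ hh
  · unfold capriniBound
    rw [integral_mul_const, integral_div]
    rfl

theorem IsMinimizer.optimalityCondition {σ₀ σ : Measure ℝ≥0} {x₀ δ : ℝ} (hx₀ : 0 < x₀)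
    (hδ : 0 < laplace σ₀ x₀ + δ) (hσ₀ : MemC2 σ₀) (h : IsMinimizer σ₀ x₀ δ σ) :
    OptimalityCondition σ₀ x₀ δ σ := by
  obtain ⟨hσ, hσc⟩ := isAdmissible_iff.1 h.1
  have hvar := (isMinimizer_iff_integral hx₀ hσ₀ hσ hσc).1 h
  have hle : ∀ t : ℝ≥0, capriniBound σ σ₀ x₀ δ t ≤ caprini σ σ₀ t := by
    intro t
    set c := laplace σ₀ x₀ + δ with hc
    have hw : 0 < c * Real.exp (x₀ * t) := by positivity
    -- The weight `c e^{x₀t}` is the one for which a point mass at `t` satisfies the constraint.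
    have h1 := hvar ((c * Real.exp (x₀ * t)).toNNReal • Measure.dirac t) (memC2_smul_dirac _ _) (by
      rw [laplace_smul_dirac, Real.coe_toNNReal _ hw.le, mul_assoc, ← Real.exp_add]
      simp)
    have h2 : ∫ x in Ioo (0 : ℝ) 1, laplace ((c * Real.exp (x₀ * t)).toNNReal • Measure.dirac t) x *
        (laplace σ x - laplace σ₀ x) = c * Real.exp (x₀ * t) * caprini σ σ₀ t := by
      simp_rw [laplace_smul_dirac, Real.coe_toNNReal _ hw.le, mul_assoc (c * Real.exp (x₀ * t))]
      rw [integral_const_mul]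
      rfl
    rw [h2] at h1
    rw [capriniBound, ← hc, neg_mul, Real.exp_neg]
    calc _ ≤ (Real.exp (x₀ * t))⁻¹ / c * (c * Real.exp (x₀ * t) * caprini σ σ₀ t) := by gcongr
      _ = _ := by field_simp
  refine ⟨hle, fun t ht => ?_⟩
  have h0 : ∫ t : ℝ≥0, capriniGap σ σ₀ x₀ δ t ∂σ = 0 := by
    rw [integral_capriniGap hx₀ δ hσ hσ₀ hσ, hσc, div_self hδ.ne', one_mul, sub_self]
  have hnonneg : 0 ≤ fun t : ℝ≥0 => capriniGap σ σ₀ x₀ δ t := fun t => sub_nonneg.2 (hle t)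
  rw [integral_eq_zero_iff_of_nonneg hnonneg (integrable_capriniGap hx₀ δ hσ hσ₀ hσ)] at h0
  have hcl : IsClosed {t : ℝ≥0 | capriniGap σ σ₀ x₀ δ t = 0} :=
    isClosed_eq (continuous_capriniGap hσ hσ₀ x₀ δ) continuous_const
  -- The gap vanishes `σ`-almost everywhere and is continuous, hence vanishes on the closed support.
  exact sub_eq_zero.1 (Measure.support_subset_of_isClosed hcl h0 ht)

theorem OptimalityCondition.isMinimizer {σ₀ σ : Measure ℝ≥0} {x₀ δ : ℝ} (hx₀ : 0 < x₀)
    (hδ : 0 < laplace σ₀ x₀ + δ) (hσ₀ : MemC2 σ₀) (hσ : MemC2 σ)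
    (h : OptimalityCondition σ₀ x₀ δ σ) (hne : σ ≠ σ₀) : IsMinimizer σ₀ x₀ δ σ := by
  have hh := hσ.memLp_sub hσ₀
  set A := ∫ x in Ioo (0 : ℝ) 1, laplace σ x * (laplace σ x - laplace σ₀ x) with hA
  have hnonneg : ∀ τ, MemC2 τ → laplace τ x₀ / (laplace σ₀ x₀ + δ) * A ≤
      ∫ x in Ioo (0 : ℝ) 1, laplace τ x * (laplace σ x - laplace σ₀ x) := by
    intro τ hτ
    have h1 := integral_capriniGap hx₀ δ hσ hσ₀ hτ
    have h2 : 0 ≤ ∫ t : ℝ≥0, capriniGap σ σ₀ x₀ δ t ∂τ :=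
      integral_nonneg fun t => sub_nonneg.2 (h.1 t)
    linarith
  have hzero : A - laplace σ x₀ / (laplace σ₀ x₀ + δ) * A = 0 := by
    rw [hA, ← integral_capriniGap hx₀ δ hσ hσ₀ hσ]
    refine integral_eq_zero_of_ae ?_
    filter_upwards [Measure.support_mem_ae (μ := σ)] with t ht
    exact sub_eq_zero.2 (h.2 t ht)
  -- If `A = 0`, the competitor `σ₀` gives `∫ f_{σ₀}(f_σ - f_{σ₀}) ≥ 0`, so `‖f_σ - f_{σ₀}‖² ≤ 0`.
  -- Once `A ≠ 0`, `hzero` forces the constraint.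
  have hA0 : A ≠ 0 := by
    intro hA0
    refine hne (hσ.eq_of_integral_sq_sub_nonpos hσ₀ ?_)
    have h1 := hnonneg σ₀ hσ₀
    have h2 : ∫ x in Ioo (0 : ℝ) 1, (laplace σ x - laplace σ₀ x) ^ 2 =
        A - ∫ x in Ioo (0 : ℝ) 1, laplace σ₀ x * (laplace σ x - laplace σ₀ x) := by
      rw [hA, ← integral_sub (hσ.integrable_mul hh) (hσ₀.integrable_mul hh)]
      congr 1 with x
      ring
    rw [hA0, mul_zero] at h1
    linarith
  have hσc : laplace σ x₀ = laplace σ₀ x₀ + δ := by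
    have h1 : (1 - laplace σ x₀ / (laplace σ₀ x₀ + δ)) * A = 0 := by linarith
    have h2 := (mul_eq_zero.1 h1).resolve_right hA0
    rw [sub_eq_zero, eq_div_iff hδ.ne'] at h2
    linarith
  refine (isMinimizer_iff_integral hx₀ hσ₀ hσ hσc).2 fun τ hτ hτc => ?_
  have := hnonneg τ hτ
  rwa [hτc, div_self hδ.ne', one_mul] at this

end Optimality

/-! ### Blaschke condition for positive zeros -/

section Blaschke
open Complex Filter Asymptotics Bornology in
/-- Dividing out a positive real zero of an entire function that is bounded on the right half-plane
by the corresponding Blaschke factor. -/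
theorem exists_blaschke_quotient {G : ℂ → ℂ} (hG : Differentiable ℂ G) {M : ℝ}
    (hM : ∀ z : ℂ, 0 ≤ z.re → ‖G z‖ ≤ M) {t : ℝ} (ht : 0 < t) (h0 : G t = 0) :
    ∃ g : ℂ → ℂ, Differentiable ℂ g ∧ (∀ z : ℂ, 0 ≤ z.re → ‖g z‖ ≤ M) ∧
      ∀ z, (z - t) * g z = (z + t) * G z := by
  set g : ℂ → ℂ := fun z => dslope G t z * (z + t) with hg
  have hd : Differentiable ℂ (dslope G (t : ℂ)) := by
    rw [← differentiableOn_univ, differentiableOn_dslope univ_mem]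
    exact hG.differentiableOn
  have hgd : Differentiable ℂ g := hd.mul (by fun_prop)
  have key : ∀ z, (z - t) * g z = (z + t) * G z := by
    intro z
    have := sub_smul_dslope G (t : ℂ) z
    rw [h0, sub_zero, smul_eq_mul] at this
    rw [hg, ← this]; ring
  refine ⟨g, hgd, ?_, key⟩
  have hM0 : 0 ≤ M := (norm_nonneg _).trans (hM 0 le_rfl)
  -- This crude bound only supplies the growth hypotheses of Phragmén–Lindelöf. The sharp constant
  -- `M` comes from the imaginary axis, where `‖z - t‖ = ‖z + t‖`.
  have hfar : ∀ z : ℂ, 0 ≤ z.re → 1 ≤ ‖z - t‖ → ‖g z‖ ≤ (1 + 2 * t) * M := by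
    intro z hz h1
    have h2 : ‖z - t‖ * ‖g z‖ = ‖z + t‖ * ‖G z‖ := by rw [← norm_mul, key, norm_mul]
    have h3 : ‖z + t‖ ≤ ‖z - t‖ + 2 * t := by
      calc ‖z + t‖ = ‖(z - t) + (2 * t : ℝ)‖ := by push_cast; ring_nf
        _ ≤ ‖z - t‖ + ‖((2 * t : ℝ) : ℂ)‖ := norm_add_le _ _
        _ = _ := by rw [Complex.norm_of_nonneg (by positivity)]
    have h4 : ‖z + t‖ ≤ (1 + 2 * t) * ‖z - t‖ := by nlinarith
    have h5 : ‖z - t‖ * ‖g z‖ ≤ ‖z - t‖ * ((1 + 2 * t) * M) := by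
      rw [h2]
      calc ‖z + t‖ * ‖G z‖ ≤ ((1 + 2 * t) * ‖z - t‖) * M := by
            gcongr; exact hM z hz
        _ = _ := by ring
    exact le_of_mul_le_mul_left h5 (by linarith)
  intro z hz
  refine PhragmenLindelof.right_half_plane_of_bounded_on_real hgd.diffContOnCl
    ⟨0, by norm_num, 0, ?_⟩ ?_ ?_ hz
  · refine IsBigO.of_bound ((1 + 2 * t) * M) ?_
    have h1 : ∀ᶠ z : ℂ in cobounded ℂ, 1 + t ≤ ‖z‖ :=
      tendsto_norm_cobounded_atTop.eventually_ge_atTop _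
    filter_upwards [h1.filter_mono inf_le_left, mem_inf_of_right (mem_principal_self _)]
      with z hz1 hz2
    have : 1 ≤ ‖z - t‖ := by
      have := norm_sub_norm_le z t
      rw [Complex.norm_of_nonneg ht.le] at this
      linarith
    simpa using hfar z (le_of_lt hz2) this
  · refine ⟨(1 + 2 * t) * M, ?_⟩
    rw [eventually_map]
    filter_upwards [eventually_ge_atTop (1 + t)] with x hx
    refine hfar x (by simp; linarith) ?_
    rw [← ofReal_sub, Complex.norm_of_nonneg (by linarith)]
    linarith
  · intro x
    have h2 : ‖(x * I : ℂ) - t‖ * ‖g (x * I)‖ = ‖(x * I : ℂ) + t‖ * ‖G (x * I)‖ := by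
      rw [← norm_mul, key, norm_mul]
    have h3 : ‖(x * I : ℂ) - t‖ = ‖(x * I : ℂ) + t‖ := by
      simp [Complex.norm_def, Complex.normSq_apply]
    have h4 : 0 < ‖(x * I : ℂ) + t‖ := by
      rw [norm_pos_iff]
      intro h
      have := congrArg Complex.re h
      simp at this
      exact ht.ne' this
    rw [h3] at h2
    rw [mul_left_cancel₀ h4.ne' h2]
    exact hM _ (by simp)

/-- The Blaschke bound for an entire function that is bounded on the right half-plane. -/
theorem norm_le_mul_prod_of_zeros (S : Finset ℝ) : ∀ {G : ℂ → ℂ}, Differentiable ℂ G →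
    ∀ {M : ℝ}, (∀ z : ℂ, 0 ≤ z.re → ‖G z‖ ≤ M) → (∀ t ∈ S, 0 < t ∧ G t = 0) →
    ∀ {a : ℝ}, 0 < a → ‖G a‖ ≤ M * ∏ t ∈ S, |a - t| / (a + t) := by
  induction S using Finset.induction_on with
  | empty => intro G _ M hM _ a ha; simpa using hM a (by simpa using ha.le)
  | insert t S hts ih =>
    intro G hG M hM hS a ha
    obtain ⟨ht, h0⟩ := hS t (Finset.mem_insert_self _ _)
    obtain ⟨g, hg, hgM, key⟩ := exists_blaschke_quotient hG hM ht h0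
    have hgS : ∀ s ∈ S, 0 < s ∧ g s = 0 := by
      intro s hs
      obtain ⟨hs0, hGs⟩ := hS s (Finset.mem_insert_of_mem hs)
      refine ⟨hs0, ?_⟩
      have := key s
      rw [hGs, mul_zero, mul_eq_zero, sub_eq_zero] at this
      rcases this with h | h
      · exact absurd (Complex.ofReal_injective h ▸ hs) hts
      · exact h
    have hb := ih hg hgM hgS ha
    have h2 : |a - t| * ‖g a‖ = (a + t) * ‖G a‖ := by
      have := congrArg norm (key a)
      rw [norm_mul, norm_mul, ← Complex.ofReal_sub, ← Complex.ofReal_add, Complex.norm_real,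
        Complex.norm_real, Real.norm_eq_abs, Real.norm_eq_abs, abs_of_pos (a := a + t)
          (by linarith)] at this
      exact this
    rw [Finset.prod_insert hts]
    have h3 : ‖G a‖ = |a - t| / (a + t) * ‖g a‖ := by
      field_simp
      linarith
    rw [h3]
    calc _ ≤ |a - t| / (a + t) * (M * ∏ s ∈ S, |a - s| / (a + s)) := by gcongr
      _ = _ := by ring

/-- The positive zeros `t` of an entire function `G ≢ 0` that is bounded on the right half-plane
satisfy the Blaschke condition `∑ 1 / t < ∞`. -/
theorem summable_one_div_zeros {G : ℂ → ℂ} (hG : Differentiable ℂ G) {M : ℝ}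
    (hM : ∀ z : ℂ, 0 ≤ z.re → ‖G z‖ ≤ M) (hne : ∃ a : ℝ, 0 < a ∧ G a ≠ 0) :
    Summable fun t : {t : ℝ≥0 | G ((t : ℝ) : ℂ) = 0} => 1 / ((t : ℝ≥0) : ℝ) := by
  classical
  obtain ⟨a, ha, hGa⟩ := hne
  set Z : Set ℝ≥0 := {t : ℝ≥0 | G ((t : ℝ) : ℂ) = 0} with hZ
  have hGa' : 0 < ‖G a‖ := norm_pos_iff.2 hGa
  have hMpos : 0 < M := hGa'.trans_le (hM a (by simpa using ha.le))
  -- finitely many zeros in `[0, a]`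
  have hfin : (Z ∩ Iic ⟨a, ha.le⟩).Finite := by
    by_contra hinf
    have hinf : (Z ∩ Iic ⟨a, ha.le⟩).Infinite := hinf
    -- Infinitely many zeros in a compact interval accumulate, and the identity theorem would give
    -- `G a = 0`.
    obtain ⟨s, -, hs⟩ := hinf.exists_accPt_of_subset_isCompact (K := Icc 0 ⟨a, ha.le⟩)
      isCompact_Icc (fun t ht => ⟨zero_le, ht.2⟩)
    have hfr : ∃ᶠ z in nhdsWithin ((s : ℝ) : ℂ) {((s : ℝ) : ℂ)}ᶜ, G z = 0 := by
      have h1 : ∃ᶠ t in nhdsWithin s {s}ᶜ, t ∈ Z :=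
        (accPt_iff_frequently_nhdsNE.1 hs).mono fun t ht => ht.1
      refine Filter.Tendsto.frequently (f := fun t : ℝ≥0 => ((t : ℝ) : ℂ)) ?_ h1
      refine tendsto_nhdsWithin_iff.2 ⟨?_, ?_⟩
      · exact ((by fun_prop : Continuous fun t : ℝ≥0 => ((t : ℝ) : ℂ)).tendsto s).mono_left
          nhdsWithin_le_nhds
      · filter_upwards [self_mem_nhdsWithin] with t ht h
        exact ht (NNReal.coe_injective (Complex.ofReal_injective h))
    have := (hG.differentiableOn.analyticOnNhd isOpen_univ).eqOn_zero_of_preconnected_of_frequently_eq_zero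
      isPreconnected_univ (mem_univ _) hfr
    exact hGa (this (mem_univ _))
  have hmain : Summable fun t : (Z \ (Z ∩ Iic ⟨a, ha.le⟩) : Set ℝ≥0) => 1 / ((t : ℝ≥0) : ℝ) := by
    refine summable_of_sum_le (c := Real.log (M / ‖G a‖) / a) (fun t => by positivity) ?_
    intro u
    have hmem : ∀ t ∈ u, a < ((t : ℝ≥0) : ℝ) := by
      intro t _
      have h := t.2.2
      by_contra hcon
      exact h ⟨t.2.1, (not_lt.1 hcon : ((t : ℝ≥0) : ℝ) ≤ a)⟩
    have hinj : Set.InjOn (fun t : (Z \ (Z ∩ Iic ⟨a, ha.le⟩) : Set ℝ≥0) => ((t : ℝ≥0) : ℝ)) u :=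
      fun s _ t _ h => Subtype.ext (NNReal.coe_injective h)
    have hb := norm_le_mul_prod_of_zeros (Finset.image (fun t : (Z \ (Z ∩ Iic ⟨a, ha.le⟩) : Set ℝ≥0) => ((t : ℝ≥0) : ℝ)) u) hG hM (by
      intro t ht
      obtain ⟨s, hs, rfl⟩ := Finset.mem_image.1 ht
      exact ⟨ha.trans (hmem s hs), s.2.1⟩) ha
    rw [Finset.prod_image hinj] at hb
    -- For `t > a`, `(t - a)/(t + a) ≤ 1 - a/t ≤ e^{-a/t}`; taking logarithms in the Blaschke bound
    -- then bounds the partial sums.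
    have hprod : ∏ t ∈ u, |a - ((t : ℝ≥0) : ℝ)| / (a + ((t : ℝ≥0) : ℝ)) ≤
        Real.exp (-(a * ∑ t ∈ u, 1 / ((t : ℝ≥0) : ℝ))) := by
      rw [Finset.mul_sum, ← Finset.sum_neg_distrib, Real.exp_sum]
      refine Finset.prod_le_prod (fun t _ => by positivity) fun t ht => ?_
      have hat := hmem t ht
      refine le_trans ?_ (Real.one_sub_le_exp_neg _)
      rw [abs_of_neg (by linarith), div_le_iff₀ (by linarith)]
      have ht0 : 0 < ((t : ℝ≥0) : ℝ) := ha.trans hat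
      field_simp
      nlinarith
    have h1 : ‖G a‖ / M ≤ Real.exp (-(a * ∑ t ∈ u, 1 / ((t : ℝ≥0) : ℝ))) := by
      rw [div_le_iff₀ hMpos, mul_comm]
      exact hb.trans (mul_le_mul_of_nonneg_left hprod hMpos.le)
    have h2 := (Real.log_le_iff_le_exp (by positivity)).2 h1
    rw [le_div_iff₀ ha, ← inv_div, Real.log_inv]
    linarith
  have hunion : Z = (Z ∩ Iic ⟨a, ha.le⟩) ∪ (Z \ (Z ∩ Iic ⟨a, ha.le⟩)) :=
    (union_sdiff_cancel inter_subset_left).symm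
  change Summable ((fun t : ℝ≥0 => 1 / (t : ℝ)) ∘ ((↑) : Z → ℝ≥0))
  rw [summable_subtype_iff_indicator, hunion, indicator_union_of_disjoint disjoint_sdiff_right]
  exact (summable_subtype_iff_indicator.1 (hfin.summable _)).add
    (summable_subtype_iff_indicator.1 hmain)

end Blaschke

/-! ### Entire extension of the gap and sparsity of the support -/

section SparseSupport
open ProbabilityTheory Filter Topology

/-- The measure `f_σ(x) dx` on `(0, 1)`. -/
noncomputable def density (σ : Measure ℝ≥0) : Measure ℝ :=
  (volume.restrict (Ioo (0 : ℝ) 1)).withDensity fun x => ENNReal.ofReal (laplace σ x)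

theorem ae_density (σ : Measure ℝ≥0) : ∀ᵐ x ∂(density σ), x ∈ Ioo (0 : ℝ) 1 :=
  (withDensity_absolutelyContinuous _ _).ae_le (ae_restrict_mem measurableSet_Ioo)

theorem MemC2.isFiniteMeasure_density {σ : Measure ℝ≥0} (hσ : MemC2 σ) :
    IsFiniteMeasure (density σ) :=
  isFiniteMeasure_withDensity_ofReal (hσ.memLp.integrable one_le_two).2

theorem MemC2.integrable_exp_density {σ : Measure ℝ≥0} (hσ : MemC2 σ) (s : ℝ) :
    Integrable (fun x => Real.exp (s * id x)) (density σ) := by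
  have := hσ.isFiniteMeasure_density
  refine Integrable.of_bound (C := Real.exp |s|)
    (Continuous.aestronglyMeasurable (by simp only [id]; fun_prop)) ?_
  filter_upwards [ae_density σ] with x hx
  rw [Real.norm_of_nonneg (Real.exp_pos _).le]
  refine Real.exp_le_exp.2 ((le_abs_self _).trans ?_)
  rw [abs_mul, id, abs_of_pos hx.1]
  exact mul_le_of_le_one_right (abs_nonneg _) hx.2.le

theorem MemC2.integrableExpSet_density {σ : Measure ℝ≥0} (hσ : MemC2 σ) :
    integrableExpSet id (density σ) = univ :=
  eq_univ_of_forall hσ.integrable_exp_density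

theorem MemC2.differentiable_complexMGF_density {σ : Measure ℝ≥0} (hσ : MemC2 σ) :
    Differentiable ℂ (complexMGF id (density σ)) := fun z =>
  (hasDerivAt_complexMGF (by simp [hσ.integrableExpSet_density])).differentiableAt

theorem MemC2.integrable_cexp_density {σ : Measure ℝ≥0} (hσ : MemC2 σ) (z : ℂ) :
    Integrable (fun x : ℝ => Complex.exp (z * (id x : ℝ))) (density σ) := by
  refine (hσ.integrable_exp_density z.re).mono'
    (Continuous.aestronglyMeasurable (by simp only [id]; fun_prop)) (.of_forall fun x => ?_)
  simp [Complex.norm_exp]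

theorem MemC2.norm_complexMGF_density_le {σ : Measure ℝ≥0} (hσ : MemC2 σ) {z : ℂ}
    (hz : z.re ≤ 0) : ‖complexMGF id (density σ) z‖ ≤ mgf id (density σ) 0 := by
  refine norm_complexMGF_le_mgf.trans ?_
  refine integral_mono_ae (hσ.integrable_exp_density _) (hσ.integrable_exp_density _) ?_
  filter_upwards [ae_density σ] with x hx
  refine Real.exp_le_exp.2 ?_
  rw [zero_mul]
  exact mul_nonpos_of_nonpos_of_nonneg hz hx.1.le

theorem MemC2.mgf_density {σ : Measure ℝ≥0} (hσ : MemC2 σ) (s : ℝ) :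
    mgf id (density σ) s = ∫ x in Ioo (0 : ℝ) 1, Real.exp (s * x) * laplace σ x := by
  rw [mgf, density, integral_withDensity_eq_integral_toReal_smul₀
    hσ.memLp.aestronglyMeasurable.aemeasurable.ennreal_ofReal (by simp)]
  refine integral_congr_ae (.of_forall fun x => ?_)
  simp only [smul_eq_mul, id]
  rw [ENNReal.toReal_ofReal (laplace_nonneg _ _), mul_comm]

theorem MemC2.integrable_exp_mul {σ : Measure ℝ≥0} (hσ : MemC2 σ) (t : ℝ) :
    IntegrableOn (fun x => Real.exp (-x * t) * laplace σ x) (Ioo 0 1) := by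
  refine Integrable.bdd_mul (c := Real.exp |t|) (hσ.memLp.integrable one_le_two)
    (Continuous.aestronglyMeasurable (by fun_prop)) ?_
  filter_upwards [ae_restrict_mem measurableSet_Ioo] with x hx
  rw [Real.norm_of_nonneg (Real.exp_pos _).le]
  refine Real.exp_le_exp.2 ((le_abs_self _).trans ?_)
  rw [abs_mul, abs_neg, abs_of_pos hx.1]
  exact mul_le_of_le_one_left (abs_nonneg _) hx.2.le

/-- `f_σ dx` and `f_τ dx` cannot differ by a point mass outside `(0, 1)`. -/
theorem MemC2.eq_of_complexMGF_density {σ τ : Measure ℝ≥0} (hσ : MemC2 σ) (hτ : MemC2 τ)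
    {x₀ K : ℝ} (hx₀ : 1 ≤ x₀)
    (h : ∀ z : ℂ, complexMGF id (density σ) z =
      complexMGF id (density τ) z + K * Complex.exp (z * x₀)) : σ = τ := by
  have := hσ.isFiniteMeasure_density
  have := hτ.isFiniteMeasure_density
  have hadd : ∀ ρ : Measure ℝ≥0, MemC2 ρ → ∀ (a : ℝ≥0) (z : ℂ),
      complexMGF id (density ρ + a • Measure.dirac x₀) z =
        complexMGF id (density ρ) z + (a : ℝ) * Complex.exp (z * x₀) := by
    intro ρ hρ a z
    rw [complexMGF, integral_add_measure (hρ.integrable_cexp_density z)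
      (integrable_dirac (by simp)).smul_measure_nnreal, integral_smul_nnreal_measure,
      integral_dirac, NNReal.smul_def, Complex.real_smul]
    rfl
  -- `K` may have either sign, so its positive and negative parts go to opposite sides to compare
  -- positive measures.
  have heq : density σ + (-K).toNNReal • Measure.dirac x₀ =
      density τ + K.toNNReal • Measure.dirac x₀ := by
    refine Measure.ext_of_complexMGF_id_eq (funext fun z => ?_)
    have hK : (K : ℂ) = (K.toNNReal : ℝ) - ((-K).toNNReal : ℝ) := by
      rw [← Complex.ofReal_sub]
      congr 1
      rcases le_total 0 K with hK | hK <;> simp [hK]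
    rw [hadd σ hσ, hadd τ hτ, h, hK]
    ring
  have hr := congrArg (fun μ : Measure ℝ => μ.restrict (Ioo (0 : ℝ) 1)) heq
  have hd : ∀ a : ℝ≥0, (a • Measure.dirac x₀ : Measure ℝ).restrict (Ioo (0 : ℝ) 1) = 0 := by
    intro a
    rw [Measure.restrict_eq_zero]
    simp [hx₀]
  simp only [Measure.restrict_add, hd, add_zero] at hr
  rw [Measure.restrict_eq_self_of_ae_mem (ae_density σ),
    Measure.restrict_eq_self_of_ae_mem (ae_density τ)] at hr
  have hfin : ∫⁻ x in Ioo (0 : ℝ) 1, ENNReal.ofReal (laplace σ x) ≠ ⊤ :=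
    (hσ.memLp.integrable one_le_two).lintegral_lt_top.ne
  have hr := (withDensity_eq_iff hσ.memLp.aestronglyMeasurable.aemeasurable.ennreal_ofReal
    hτ.memLp.aestronglyMeasurable.aemeasurable.ennreal_ofReal hfin).1 hr
  refine hσ.eq_of_laplace_ae_eq hτ ?_
  filter_upwards [hr] with x hx
  exact (ENNReal.ofReal_eq_ofReal_iff (laplace_nonneg _ _) (laplace_nonneg _ _)).1 hx

theorem hasSparseSupport_of_summable {σ : Measure ℝ≥0} {Z : Set ℝ≥0} (hZ : σ.support ⊆ Z)
    (h : Summable fun t : Z => 1 / ((t : ℝ≥0) : ℝ)) : HasSparseSupport σ := by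
  have hs : Summable ((fun t : Z => 1 / ((t : ℝ≥0) : ℝ)) ∘ inclusion hZ) :=
    h.comp_injective (inclusion_injective hZ)
  replace hs : Summable fun t : σ.support => 1 / ((t : ℝ≥0) : ℝ) := hs
  by_cases hfin : σ.support.Finite
  · exact Or.inl hfin
  refine Or.inr ?_
  have hinf : Infinite σ.support := infinite_coe_iff.2 hfin
  -- A summable family has countably many nonzero terms, and only `t = 0` gives a zero term.
  have hcount : σ.support.Countable := by
    refine ((hs.countable_support.image Subtype.val).union (countable_singleton 0)).mono ?_
    intro t ht
    by_cases h0 : t = 0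
    · exact Or.inr h0
    · exact Or.inl ⟨⟨t, ht⟩, by simpa using h0, rfl⟩
  have := hcount.to_subtype
  obtain ⟨hden⟩ := nonempty_denumerable σ.support
  let e := (Denumerable.eqv σ.support).symm
  refine ⟨fun n => e n, Subtype.val_injective.comp e.injective, ?_, hs.comp_injective e.injective⟩
  rw [show (fun n => ((e n : σ.support) : ℝ≥0)) = Subtype.val ∘ e from rfl,
    e.surjective.range_comp, Subtype.range_coe]

theorem OptimalityCondition.hasSparseSupport {σ₀ σ : Measure ℝ≥0} {x₀ δ : ℝ} (hx₀ : 1 ≤ x₀)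
    (hσ₀ : MemC2 σ₀) (hσ : MemC2 σ) (h : OptimalityCondition σ₀ x₀ δ σ) (hne : σ ≠ σ₀) :
    HasSparseSupport σ := by
  set K : ℝ := (∫ x in Ioo (0 : ℝ) 1, laplace σ x * (laplace σ x - laplace σ₀ x)) /
    (laplace σ₀ x₀ + δ) with hK
  let G : ℂ → ℂ := fun z => complexMGF id (density σ) (-z) - complexMGF id (density σ₀) (-z) -
    K * Complex.exp (-z * x₀)
  have hG : Differentiable ℂ G := by
    refine ((hσ.differentiable_complexMGF_density.comp differentiable_neg).sub
      (hσ₀.differentiable_complexMGF_density.comp differentiable_neg)).sub ?_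
    fun_prop
  have hGreal : ∀ t : ℝ, G t = (caprini σ σ₀ t - capriniBound σ σ₀ x₀ δ t : ℝ) := by
    intro t
    have h1 : caprini σ σ₀ t = mgf id (density σ) (-t) - mgf id (density σ₀) (-t) := by
      rw [hσ.mgf_density, hσ₀.mgf_density, caprini]
      have := integral_sub (hσ.integrable_exp_mul t) (hσ₀.integrable_exp_mul t)
      simp_rw [mul_sub]
      rw [this]
      congr 3 <;> · ext x; ring_nf
    have h2 : capriniBound σ σ₀ x₀ δ t = K * Real.exp (-t * x₀) := by
      rw [capriniBound, hK, show -x₀ * t = -t * x₀ by ring]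
      ring
    rw [h1, h2]
    simp only [G]
    rw [← Complex.ofReal_neg, complexMGF_ofReal, complexMGF_ofReal]
    push_cast
    rfl
  have hM : ∀ z : ℂ, 0 ≤ z.re →
      ‖G z‖ ≤ mgf id (density σ) 0 + mgf id (density σ₀) 0 + |K| := by
    intro z hz
    have hz' : (-z).re ≤ 0 := by simpa using hz
    refine (norm_sub_le _ _).trans (add_le_add ((norm_sub_le _ _).trans (add_le_add
      (hσ.norm_complexMGF_density_le hz') (hσ₀.norm_complexMGF_density_le hz'))) ?_)
    rw [norm_mul, Complex.norm_real, Real.norm_eq_abs, Complex.norm_exp]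
    refine mul_le_of_le_one_right (abs_nonneg _) (Real.exp_le_one_iff.2 ?_)
    simp only [Complex.mul_re, Complex.neg_re, Complex.ofReal_re, Complex.ofReal_im, mul_zero,
      sub_zero]
    nlinarith
  -- If `G` vanished on the positive axis it would vanish on `ℂ`, making `f_σ dx` equal to `f_{σ₀}
  -- dx` plus `K` times the unit mass at `x₀`.
  have hnz : ∃ a : ℝ, 0 < a ∧ G a ≠ 0 := by
    by_contra! hzero
    refine hne (hσ.eq_of_complexMGF_density hσ₀ (K := K) hx₀ fun z => ?_)
    have hfr : ∃ᶠ z in 𝓝[≠] (1 : ℂ), G z = 0 := by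
      have h1 : ∀ᶠ x : ℝ in 𝓝[≠] 1, G x = 0 :=
        nhdsWithin_le_nhds (Filter.mem_of_superset (Ioi_mem_nhds one_pos) hzero)
      refine Tendsto.frequently (f := fun x : ℝ => (x : ℂ)) ?_ h1.frequently
      refine tendsto_nhdsWithin_iff.2 ⟨?_, ?_⟩
      · exact (Continuous.tendsto' (by fun_prop) _ _ (by simp)).mono_left nhdsWithin_le_nhds
      · filter_upwards [self_mem_nhdsWithin] with x hx h
        exact hx (Complex.ofReal_injective (by simpa using h))
    have h0 := (hG.differentiableOn.analyticOnNhd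
      isOpen_univ).eqOn_zero_of_preconnected_of_frequently_eq_zero isPreconnected_univ
      (mem_univ _) hfr (mem_univ (-z))
    simp only [G, neg_neg, Pi.zero_apply] at h0
    linear_combination h0
  refine hasSparseSupport_of_summable (fun t ht => ?_) (summable_one_div_zeros hG hM hnz)
  change G ((t : ℝ) : ℂ) = 0
  rw [hGreal, h.2 t ht, sub_self, Complex.ofReal_zero]

end SparseSupport
end CMF

theorem theorem7p1 (σ₀ : MeasureTheory.Measure ℝ≥0) (hσ₀ : CMF.MemC2 σ₀)
    (x₀ : ℝ) (hx₀ : 1 ≤ x₀) (δ : ℝ) (hδ : 0 < CMF.laplace σ₀ x₀ + δ) :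
    (∃! σ : MeasureTheory.Measure ℝ≥0, CMF.IsMinimizer σ₀ x₀ δ σ) ∧
    (∀ σ : MeasureTheory.Measure ℝ≥0, CMF.IsMinimizer σ₀ x₀ δ σ →
      (δ ≠ 0 → CMF.HasSparseSupport σ) ∧ CMF.OptimalityCondition σ₀ x₀ δ σ) ∧
    (∀ σ : MeasureTheory.Measure ℝ≥0, CMF.MemC2 σ → CMF.HasSparseSupport σ →
      CMF.OptimalityCondition σ₀ x₀ δ σ → σ ≠ σ₀ → CMF.IsMinimizer σ₀ x₀ δ σ) := by
  have hx : 0 < x₀ := one_pos.trans_le hx₀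
  refine ⟨?_, fun σ hσ => ?_, fun σ hσ _ h hne => h.isMinimizer hx hδ hσ₀ hσ hne⟩
  · obtain ⟨σ, hσ⟩ := CMF.exists_isMinimizer hx hσ₀ hδ.le
    exact ⟨σ, hσ, fun τ hτ => hτ.unique hx hσ₀ hσ⟩
  · have hopt := hσ.optimalityCondition hx hδ hσ₀
    refine ⟨fun hδ0 => hopt.hasSparseSupport hx₀ hσ₀ hσ.1.1 ?_, hopt⟩
    rintro rfl
    exact hδ0 (by simpa using hσ.1.2.symm)
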